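/- **Theorem 1.** A finite simplicial complex $K$ has *degree bound* $d$ if every vertex of $K$ lies in at most $d$ edges. For a vertex $x$ of $K$ and $r\in\mathbb N$ the *$r$-neighbourhood* $B_r(x)$ is the subcomplex of all simplices of $K$ all of whose vertices have distance at most $r$ from $x$ in the $1$-skeleton of $K$, rooted at $x$. Let $Z^{r,d}$ be the set of rooted isomorphism classes of rooted $r$-balls of degree bound $d$, that is, of finite simplicial complexes of degree bound $d$ with a distinguished vertex from which every vertex has distance at most $r$ in the $1$-skeleton. Let $b^p(K)=\dim H^p(K;\mathbb R)$ and let $V(K)$ be the set of vertices of $K$. Betti numbers are testable in constant time for simplicial complexes of bounded degree. Precisely: for every $d\in\mathbb N$ and $\varepsilon>0$ there is $C=C(d,\varepsilon)\in\mathbb N$ such that the set $Z^{C,d}$ is finite and, for every $p\ge 0$, there is a function (the tester, a finite table) $T\colon (Z^{C,d})^C\to\mathbb Q$ with the following property. For every nonempty finite simplicial complex $K$ of degree bound $d$, if $x_1,\dots,x_C$ are independent, uniformly distributed random vertices of $K$ and $$\hat b^p(K):=|V(K)|\cdot T\big([B_C(x_1)],\dots,[B_C(x_C)]\big),$$ then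 $$\mathrm{Prob}\left(\frac{|\hat b^p(K)-b^p(K)|}{|V(K)|}>\varepsilon\right)<\varepsilon .$$ -/

import Mathlib

universe u

namespace BettiTesting

open Classical in
/-- The `1`-skeleton of a simplicial complex: the graph on its vertices whose edges are
the two-element faces. -/
def skeleton {V : Type u} (K : AbstractSimplicialComplex V) : SimpleGraph V where
  Adj x y := x ≠ y ∧ ({x, y} : Finset V) ∈ K.faces
  symm := ⟨fun x y h => ⟨h.1.symm, by rw [Finset.pair_comm]; exact h.2⟩⟩
  loopless := ⟨fun _ h => h.1 rfl⟩

/-- Vertex degree bound `d`: every vertex lies in at most `d` edges. -/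
def DegreeBounded {V : Type u} (K : AbstractSimplicialComplex V) (d : ℕ) : Prop :=
  ∀ v : V, ((skeleton K).neighborSet v).encard ≤ d

/-- The full subcomplex of `K` on a set `S` of vertices: all the simplices of `K` whose
vertices lie in `S`. -/
def fullSubcomplex {V : Type u} (K : AbstractSimplicialComplex V) (S : Set V) :
    AbstractSimplicialComplex S where
  faces := {s | s.map (Function.Embedding.subtype (· ∈ S)) ∈ K.faces}
  isRelLowerSet_faces := by
    intro s hs
    refine ⟨by simpa using (K.isRelLowerSet_faces hs).1, fun t hts ht => ?_⟩
    exact (K.isRelLowerSet_faces hs).2 (Finset.map_subset_map.2 hts) (by simpa using ht)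
  singleton_mem v := by simpa using K.singleton_mem (v : V)

/-- The vertices at distance at most `r` from `x` in the `1`-skeleton. -/
def ballVertices {V : Type u} (K : AbstractSimplicialComplex V) (r : ℕ) (x : V) : Set V :=
  {y | (skeleton K).edist x y ≤ r}

/-- A rooted `r`-ball of degree bound `d`: a finite simplicial complex of vertex degree
bound `d`, with a distinguished vertex from which every vertex has distance at most `r` in
the `1`-skeleton. -/
structure RootedBall (d r : ℕ) : Type (u + 1) where
  /-- the vertices -/
  carrier : Type u
  /-- there are finitely many of them -/
  finite : Finite carrier
  /-- the simplices -/
  complex : AbstractSimplicialComplex carrier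
  degreeBounded : DegreeBounded complex d
  /-- the distinguished vertex -/
  root : carrier
  edist_le : ∀ y : carrier, (skeleton complex).edist root y ≤ r

/-- Two rooted balls are isomorphic if some bijection of the vertices preserves the root and
carries simplices to simplices in both directions. -/
def RootedBall.Iso {d r : ℕ} (A B : RootedBall.{u} d r) : Prop :=
  ∃ e : A.carrier ≃ B.carrier, e A.root = B.root ∧
    ∀ s : Finset A.carrier, s.map e.toEmbedding ∈ B.complex.faces ↔ s ∈ A.complex.faces

/-- Rooted isomorphism is an equivalence relation. -/
instance RootedBall.setoid (d r : ℕ) : Setoid (RootedBall.{u} d r) where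
  r := RootedBall.Iso
  iseqv :=
    { refl := fun A => ⟨Equiv.refl _, rfl, fun s => by simp⟩
      symm := by
        rintro A B ⟨e, he, h⟩
        refine ⟨e.symm, by simp [← he], fun s => ?_⟩
        rw [← h, Finset.map_map]
        simp
      trans := by
        rintro A B C ⟨e, he, h⟩ ⟨f, hf, k⟩
        refine ⟨e.trans f, by simp [he, hf], fun s => ?_⟩
        rw [← h, ← k, Finset.map_map]
        rfl }

/-- The rooted isomorphism classes of rooted `r`-balls of degree bound `d`. -/
abbrev BallType (d r : ℕ) : Type (u + 1) := Quotient (RootedBall.setoid.{u} d r)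

theorem skeleton_fullSubcomplex_adj {V : Type u} (K : AbstractSimplicialComplex V) (S : Set V)
    (a b : S) : (skeleton (fullSubcomplex K S)).Adj a b ↔ (skeleton K).Adj a b := by
  classical
  have : (({a, b} : Finset S).map (Function.Embedding.subtype (· ∈ S))) = {(a : V), (b : V)} := by
    ext; simp
  simp only [skeleton, fullSubcomplex, Set.mem_ofPred_eq, ne_eq, Subtype.coe_inj]
  refine and_congr_right fun _ => ?_
  convert (Iff.rfl : ({(a : V), (b : V)} : Finset V) ∈ K.faces ↔ _)
  rw [← this]
  congr!

theorem DegreeBounded.fullSubcomplex {V : Type u} {K : AbstractSimplicialComplex V} {d : ℕ}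
    (h : DegreeBounded K d) (S : Set V) : DegreeBounded (fullSubcomplex K S) d := by
  intro v
  refine le_trans ?_ (h v)
  rw [← Function.Injective.encard_image (Subtype.val_injective (p := (· ∈ S)))]
  apply Set.encard_le_encard
  rintro _ ⟨w, hw, rfl⟩
  exact (skeleton_fullSubcomplex_adj K S v w).1 hw

theorem root_mem_ballVertices {V : Type u} (K : AbstractSimplicialComplex V) (r : ℕ) (x : V) :
    x ∈ ballVertices K r x := by
  simp [ballVertices]

theorem edist_ball_le {V : Type u} (K : AbstractSimplicialComplex V) (r : ℕ) (x : V)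
    (y : ballVertices K r x) :
    (skeleton (fullSubcomplex K (ballVertices K r x))).edist
      ⟨x, root_mem_ballVertices K r x⟩ y ≤ r := by
  have key : ∀ n : ℕ, n ≤ r → ∀ (y : V) (hy : y ∈ ballVertices K r x),
      (∃ w : (skeleton K).Walk y x, w.length = n) →
      ∃ w : (skeleton (fullSubcomplex K (ballVertices K r x))).Walk ⟨y, hy⟩
        ⟨x, root_mem_ballVertices K r x⟩, w.length = n := by
    intro n
    induction n with
    | zero =>
      rintro - y hy ⟨w, hw⟩
      obtain rfl := SimpleGraph.Walk.eq_of_length_eq_zero hw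
      exact ⟨SimpleGraph.Walk.nil, rfl⟩
    | succ n ih =>
      rintro hn y hy ⟨w, hw⟩
      cases w with
      | nil => simp at hw
      | @cons _ z _ hadj w' =>
        have hw' : w'.length = n := by simpa using hw
        have hz : z ∈ ballVertices K r x := by
          have h1 := SimpleGraph.edist_le w'
          rw [SimpleGraph.edist_comm, hw'] at h1
          exact h1.trans (by exact_mod_cast (Nat.le_succ n).trans hn)
        obtain ⟨w'', h''⟩ := ih ((Nat.le_succ n).trans hn) z hz ⟨w', hw'⟩
        exact ⟨SimpleGraph.Walk.cons
          ((skeleton_fullSubcomplex_adj K _ ⟨y, hy⟩ ⟨z, hz⟩).2 hadj) w'', by simp [h'']⟩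
  have hy : (skeleton K).edist y x ≤ r := by
    rw [SimpleGraph.edist_comm]; exact y.2
  obtain ⟨w, hw⟩ := SimpleGraph.exists_walk_of_edist_ne_top
    (ne_top_of_le_ne_top (ENat.natCast_ne_top r) hy)
  have hl : w.length ≤ r := by
    have : (w.length : ℕ∞) ≤ r := hw ▸ hy
    exact_mod_cast this
  obtain ⟨w', hw'⟩ := key _ hl y y.2 ⟨w, rfl⟩
  rw [SimpleGraph.edist_comm]
  exact (SimpleGraph.edist_le w').trans (by rw [hw']; exact_mod_cast hl)

/-- The `r`-neighbourhood of the vertex `x`: all the simplices of `K` whose vertices have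
distance at most `r` from `x`, rooted at `x`. -/
def neighbourhood {V : Type u} [Finite V] (K : AbstractSimplicialComplex V) {d : ℕ}
    (hK : DegreeBounded K d) (r : ℕ) (x : V) : RootedBall.{u} d r where
  carrier := ballVertices K r x
  finite := inferInstance
  complex := fullSubcomplex K (ballVertices K r x)
  degreeBounded := hK.fullSubcomplex _
  root := ⟨x, root_mem_ballVertices K r x⟩
  edist_le := edist_ball_le K r x

/-- What one sees of the `r`-neighbourhood of `x`: its rooted isomorphism class. -/
def neighbourhoodType {V : Type u} [Finite V] (K : AbstractSimplicialComplex V) {d : ℕ}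
    (hK : DegreeBounded K d) (r : ℕ) (x : V) : BallType.{u} d r :=
  Quotient.mk _ (neighbourhood K hK r x)

open Classical in
/-- The tuple `(a 0, …, a p)` of vertices spans a simplex of `K` (possibly of dimension less
than `p`, when there are repetitions). -/
def Spans {V : Type u} (K : AbstractSimplicialComplex V) {p : ℕ} (a : Fin (p + 1) → V) : Prop :=
  Finset.univ.image a ∈ K.faces

/-- The real `p`-cochains of `K`: the alternating functions of `p + 1` vertices which are
supported on the simplices of `K`. They vanish on tuples with a repetition. A choice of an
orientation for each simplex identifies them with the real functions on the `p`-simplices. -/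
def cochains {V : Type u} (K : AbstractSimplicialComplex V) (p : ℕ) :
    Submodule ℝ ((Fin (p + 1) → V) → ℝ) where
  carrier := {f | (∀ a, ¬ Spans K a → f a = 0) ∧
    ∀ (a : Fin (p + 1) → V) (σ : Equiv.Perm (Fin (p + 1))),
      f (a ∘ σ) = ((Equiv.Perm.sign σ : ℤ) : ℝ) * f a}
  add_mem' := by
    rintro f g ⟨hf, hf'⟩ ⟨hg, hg'⟩
    exact ⟨fun a ha => by simp [hf a ha, hg a ha],
      fun a σ => by simp only [Pi.add_apply, hf', hg']; ring⟩
  zero_mem' := ⟨fun _ _ => rfl, fun _ _ => by simp⟩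
  smul_mem' := by
    rintro c f ⟨hf, hf'⟩
    exact ⟨fun a ha => by simp [hf a ha],
      fun a σ => by simp only [Pi.smul_apply, smul_eq_mul, hf']; ring⟩

open Classical in
/-- The coboundary
`(d f) (a 0, …, a (p + 1)) = ∑ i, (-1) ^ i * f (a 0, …, a (i - 1), a (i + 1), …, a (p + 1))`
on the simplices of `K`. -/
noncomputable def coboundary {V : Type u} (K : AbstractSimplicialComplex V) (p : ℕ) :
    ((Fin (p + 1) → V) → ℝ) →ₗ[ℝ] ((Fin (p + 2) → V) → ℝ) where
  toFun f a :=
    if Spans K a then ∑ i : Fin (p + 2), (-1 : ℝ) ^ (i : ℕ) * f (a ∘ i.succAbove) else 0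
  map_add' f g := by
    ext a
    by_cases h : Spans K a <;> simp [h, mul_add, Finset.sum_add_distrib]
  map_smul' c f := by
    ext a
    by_cases h : Spans K a <;> simp [h, Finset.mul_sum, mul_left_comm]

/-- The `p`-cocycles, the kernel of `d` on `p`-cochains. -/
noncomputable def cocycles {V : Type u} (K : AbstractSimplicialComplex V) (p : ℕ) :
    Submodule ℝ ((Fin (p + 1) → V) → ℝ) :=
  cochains K p ⊓ LinearMap.ker (coboundary K p)

/-- The `p`-coboundaries, the image of `d` on `(p - 1)`-cochains (zero if `p = 0`). -/
noncomputable def coboundaries {V : Type u} (K : AbstractSimplicialComplex V) :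
    (p : ℕ) → Submodule ℝ ((Fin (p + 1) → V) → ℝ)
  | 0 => ⊥
  | p + 1 => (cochains K p).map (coboundary K p)

/-- The `p`-th real Betti number `dim Ker d_p - dim Im d_{p-1}`. -/
noncomputable def betti {V : Type u} (K : AbstractSimplicialComplex V) (p : ℕ) : ℤ :=
  (Module.finrank ℝ (cocycles K p) : ℤ) - (Module.finrank ℝ (coboundaries K p) : ℤ)

/-- The probability of the event `E` for a uniformly random element of the finite set `Ω`. -/
noncomputable def uniformProb {Ω : Type u} (E : Set Ω) : ℝ :=
  (E.ncard : ℝ) / (Nat.card Ω : ℝ)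

end BettiTesting

/-! By rank-nullity the `p`-th Betti number is `dim C^p - rank d_p - rank d_{p-1}`, so it is enough
to estimate each of these numbers up to a small multiple of `|V|` by a sum over the vertices of a
function of bounded neighbourhoods. Sampling that function then gives the tester
(`LocallyApproximable.exists_tester`).

Each of the numbers is the rank of an integer matrix `N` with local entries, hence of `A = Nᵀ * N`.
If `L` bounds the eigenvalues of `A`, then `tr (1 - (1 - A / L) ^ k)` is local, and it differs from
the rank by the sum of `(1 - λ / L) ^ k` over the nonzero eigenvalues `λ`. Small eigenvalues are the
only danger. There cannot be many of them: the product of the nonzero eigenvalues is, up to sign, a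
nonzero coefficient of an integer polynomial, so their logarithms have nonnegative sum. Since `H_k *
(1 - t) ^ k ≤ -log t` for the harmonic number `H_k`, the error is at most `log L / H_k * tr A`
(`abs_rank_sub_trace_le`), and `tr A ≤ L * |V|`. As `H_k → ∞`, a `k` depending only on `L` and `ε`
suffices (`LocallyApproximable.of_eq_rank`). -/

namespace BettiTesting

/-! ### Rank and trace of integer Gram matrices -/

/-- The nonzero eigenvalues of an integer symmetric matrix have a product of absolute value at
least one. -/
theorem one_le_abs_prod_eigenvalues {n : Type*} [Fintype n] [DecidableEq n] (A : Matrix n n ℤ)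
    (hA : (A.map (Int.cast : ℤ → ℝ)).IsHermitian) :
    1 ≤ |∏ i with hA.eigenvalues i ≠ 0, hA.eigenvalues i| := by
  have hmap : (A.map (Int.cast : ℤ → ℝ)).charpoly = A.charpoly.map (Int.castRingHom ℝ) :=
    Matrix.charpoly_map A (Int.castRingHom ℝ)
  -- The trailing coefficient is multiplicative and is here a nonzero integer. On a factor `X - 0`
  -- it equals `1`, so the zero eigenvalues drop out of the product.
  have htc : (A.map (Int.cast : ℤ → ℝ)).charpoly.trailingCoeff =
      ((A.charpoly.coeff (A.map (Int.cast : ℤ → ℝ)).charpoly.natTrailingDegree : ℤ) : ℝ) := by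
    rw [Polynomial.trailingCoeff, hmap, Polynomial.coeff_map]
    simp
  have hne : (A.map (Int.cast : ℤ → ℝ)).charpoly.trailingCoeff ≠ 0 := by
    simpa using (Matrix.charpoly_monic (A.map (Int.cast : ℤ → ℝ))).ne_zero
  have hX : ∀ c : ℝ, (Polynomial.X - Polynomial.C c).trailingCoeff = if c = 0 then 1 else -c := by
    intro c
    split_ifs with h
    · subst h
      simp [Polynomial.trailingCoeff, Polynomial.natTrailingDegree_X]
    · rw [Polynomial.trailingCoeff_eq_coeff_zero (by simpa using h)]
      simp
  have hprod : ∀ s : Finset n, (∏ i ∈ s, (Polynomial.X - Polynomial.C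
      (hA.eigenvalues i))).trailingCoeff =
      ∏ i ∈ s, if hA.eigenvalues i = 0 then 1 else -hA.eigenvalues i := by
    intro s
    induction s using Finset.induction_on with
    | empty => simp [Polynomial.trailingCoeff]
    | insert a s ha ih => rw [Finset.prod_insert ha, Finset.prod_insert ha,
        Polynomial.trailingCoeff_mul, ih, hX]
  have h1 : |(A.map (Int.cast : ℤ → ℝ)).charpoly.trailingCoeff| =
      |∏ i with hA.eigenvalues i ≠ 0, hA.eigenvalues i| := by
    rw [hA.charpoly_eq]
    have := hprod Finset.univ
    simp only [RCLike.ofReal_real_eq_id, id] at *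
    rw [this, Finset.prod_filter, Finset.abs_prod, Finset.abs_prod]
    refine Finset.prod_congr rfl fun i _ => ?_
    by_cases h : hA.eigenvalues i = 0 <;> simp [h]
  rw [← h1]
  rw [htc] at hne ⊢
  exact_mod_cast Int.one_le_abs (Int.cast_ne_zero.1 hne)

/-- The series `-log t = ∑ (1 - t) ^ (j + 1) / (j + 1)` has nonnegative terms, and in each of the
first `k` the power is at least `(1 - t) ^ k`. -/
theorem harmonic_mul_pow_le_neg_log {t : ℝ} (h0 : 0 < t) (h1 : t ≤ 1) (k : ℕ) :
    (∑ j ∈ Finset.range k, 1 / ((j : ℝ) + 1)) * (1 - t) ^ k ≤ -Real.log t := by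
  have h := Real.hasSum_pow_div_log_of_abs_lt_one (x := 1 - t) (by rw [abs_lt]; constructor <;> linarith)
  rw [sub_sub_cancel] at h
  refine le_trans ?_ (sum_le_hasSum (Finset.range k) (fun i _ => ?_) h)
  · rw [Finset.sum_mul]
    refine Finset.sum_le_sum fun j hj => ?_
    rw [one_div_mul_eq_div]
    gcongr ?_ / _
    exact pow_le_pow_of_le_one (by linarith) (by linarith) (Finset.mem_range.1 hj)
  · have : 0 ≤ 1 - t := by linarith
    positivity

theorem trace_spectral {n : Type*} [Fintype n] [DecidableEq n] {A : Matrix n n ℝ}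
    (hA : A.IsHermitian) (c : ℝ) (k : ℕ) :
    (1 - (1 - c • A) ^ k).trace = ∑ i, (1 - (1 - c * hA.eigenvalues i) ^ k) := by
  let φ := Unitary.conjStarAlgAut ℝ (Matrix n n ℝ) hA.eigenvectorUnitary
  have hs : A = φ (Matrix.diagonal hA.eigenvalues) := hA.spectral_theorem
  have h1 : 1 - (1 - c • A) ^ k =
      φ (Matrix.diagonal fun i => 1 - (1 - c * hA.eigenvalues i) ^ k) := by
    have : (Matrix.diagonal fun i => 1 - (1 - c * hA.eigenvalues i) ^ k) =
        1 - (1 - c • Matrix.diagonal hA.eigenvalues) ^ k := by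
      rw [← Matrix.diagonal_one, ← Matrix.diagonal_smul, Matrix.diagonal_sub, Matrix.diagonal_pow,
        Matrix.diagonal_sub]
      rfl
    rw [this, map_sub, map_pow, map_sub, map_one, map_smul, ← hs]
  rw [h1, Unitary.conjStarAlgAut_apply, Matrix.trace_mul_comm, ← mul_assoc]
  simp [Matrix.trace_diagonal]

/-- Gershgorin's circle theorem. -/
theorem eigenvalue_le_of_row_sum_le {n : Type*} [Fintype n] [DecidableEq n] {A : Matrix n n ℝ}
    (hA : A.IsHermitian) {L : ℝ} (hL : ∀ i, ∑ j, |A i j| ≤ L) (i : n) :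
    hA.eigenvalues i ≤ L := by
  have hev : Module.End.HasEigenvalue (Matrix.toLin' A) (hA.eigenvalues i) := by
    rw [Module.End.hasEigenvalue_iff_mem_spectrum, Matrix.spectrum_toLin']
    exact hA.eigenvalues_mem_spectrum_real i
  obtain ⟨k, hk⟩ := eigenvalue_mem_ball hev
  rw [Metric.mem_closedBall, Real.dist_eq] at hk
  have h1 := hL k
  rw [← Finset.add_sum_erase _ _ (Finset.mem_univ k)] at h1
  simp only [Real.norm_eq_abs] at hk
  have h2 := le_abs_self (hA.eigenvalues i - A k k)
  have h3 := le_abs_self (A k k)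
  linarith

-- The error is the sum of `(1 - λ / L) ^ k` over the nonzero eigenvalues. Bounding each term by
-- `(log L - log λ) / H_k` and dropping `∑ log λ ≥ 0` leaves `rank * log L / H_k`; the rank is at
-- most the trace of the Gram matrix.
open Matrix in
theorem abs_rank_sub_trace_le {m n : Type*} [Fintype m] [Fintype n] [DecidableEq n]
    (N : Matrix m n ℤ) {L : ℝ} (hL1 : 1 ≤ L) (hL : ∀ i, ((∑ j, |(Nᵀ * N) i j| : ℤ) : ℝ) ≤ L)
    {k : ℕ} (hk : 0 < k) :
    |((N.map (Int.cast : ℤ → ℝ)).rank : ℝ) -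
        (1 - (1 - L⁻¹ • (Nᵀ * N).map (Int.cast : ℤ → ℝ)) ^ k).trace| ≤
      Real.log L / (∑ j ∈ Finset.range k, 1 / ((j : ℝ) + 1)) * ((Nᵀ * N).trace : ℤ) := by
  set A := Nᵀ * N with hAdef
  set H := ∑ j ∈ Finset.range k, 1 / ((j : ℝ) + 1) with hH
  have hHpos : 0 < H := Finset.sum_pos (fun i _ => by positivity) (by simpa using hk.ne')
  have hmap : A.map (Int.cast : ℤ → ℝ) =
      (N.map (Int.cast : ℤ → ℝ))ᵀ * N.map (Int.cast : ℤ → ℝ) := by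
    rw [hAdef]
    exact Matrix.map_mul (f := Int.castRingHom ℝ)
  have hpsd : (A.map (Int.cast : ℤ → ℝ)).PosSemidef := by
    rw [hmap, ← conjTranspose_eq_transpose_of_trivial]
    exact posSemidef_conjTranspose_mul_self _
  have hA := hpsd.isHermitian
  have hrank : (N.map (Int.cast : ℤ → ℝ)).rank = (A.map (Int.cast : ℤ → ℝ)).rank := by
    rw [hmap, rank_transpose_mul_self]
  set s : Finset n := {i | hA.eigenvalues i ≠ 0} with hs
  have hpos : ∀ i ∈ s, 0 < hA.eigenvalues i := fun i hi =>
    lt_of_le_of_ne (hpsd.eigenvalues_nonneg i) (Ne.symm (by simpa [hs] using hi))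
  have hle : ∀ i, hA.eigenvalues i ≤ L := by
    refine eigenvalue_le_of_row_sum_le hA fun i => ?_
    simpa using hL i
  have hcard : ((N.map (Int.cast : ℤ → ℝ)).rank : ℝ) = ∑ i ∈ s, (1 : ℝ) := by
    rw [hrank, hA.rank_eq_card_non_zero_eigs, Fintype.card_subtype]
    simp [hs]
  have htr : (1 - (1 - L⁻¹ • A.map (Int.cast : ℤ → ℝ)) ^ k).trace =
      ∑ i ∈ s, (1 - (1 - L⁻¹ * hA.eigenvalues i) ^ k) := by
    rw [trace_spectral hA, hs, Finset.sum_filter]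
    refine Finset.sum_congr rfl fun i _ => ?_
    by_cases h : hA.eigenvalues i = 0 <;> simp [h]
  have hlog : 0 ≤ ∑ i ∈ s, Real.log (hA.eigenvalues i) := by
    rw [← Real.log_prod fun i hi => (hpos i hi).ne']
    have := one_le_abs_prod_eigenvalues A hA
    rw [abs_of_pos (Finset.prod_pos hpos)] at this
    exact Real.log_nonneg this
  -- Sum `log λ ≤ λ - 1` over the nonzero eigenvalues; the left side is nonnegative by `hlog`.
  have hcardtr : ∑ i ∈ s, (1 : ℝ) ≤ ((A.trace : ℤ) : ℝ) := by
    have h1 : ((A.trace : ℤ) : ℝ) = (A.map (Int.cast : ℤ → ℝ)).trace := by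
      simp [Matrix.trace]
    have h2 : (A.map (Int.cast : ℤ → ℝ)).trace = ∑ i ∈ s, hA.eigenvalues i := by
      rw [hA.trace_eq_sum_eigenvalues, hs, Finset.sum_filter_ne_zero]
      simp
    rw [h1, h2]
    have : ∑ i ∈ s, Real.log (hA.eigenvalues i) ≤ ∑ i ∈ s, (hA.eigenvalues i - 1) :=
      Finset.sum_le_sum fun i hi => Real.log_le_sub_one_of_pos (hpos i hi)
    rw [Finset.sum_sub_distrib] at this
    linarith
  have hterm : ∀ i ∈ s, H * (1 - L⁻¹ * hA.eigenvalues i) ^ k ≤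
      Real.log L - Real.log (hA.eigenvalues i) := by
    intro i hi
    have hp := hpos i hi
    have ht : L⁻¹ * hA.eigenvalues i ≤ 1 := by
      rw [inv_mul_le_iff₀ (by linarith)]
      simpa using hle i
    have := harmonic_mul_pow_le_neg_log (t := L⁻¹ * hA.eigenvalues i) (by positivity) ht k
    rw [Real.log_mul (by positivity) hp.ne', Real.log_inv] at this
    linarith
  have hnn : ∀ i ∈ s, 0 ≤ (1 - L⁻¹ * hA.eigenvalues i) ^ k := by
    intro i hi
    have ht : L⁻¹ * hA.eigenvalues i ≤ 1 := by
      rw [inv_mul_le_iff₀ (by linarith)]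
      simpa using hle i
    exact pow_nonneg (by linarith) _
  have hlogL : 0 ≤ Real.log L := Real.log_nonneg hL1
  have hsum : H * ∑ i ∈ s, (1 - L⁻¹ * hA.eigenvalues i) ^ k ≤
      Real.log L * ((A.trace : ℤ) : ℝ) := by
    rw [Finset.mul_sum]
    refine (Finset.sum_le_sum hterm).trans ?_
    rw [Finset.sum_sub_distrib]
    have : ∑ i ∈ s, Real.log L = Real.log L * ∑ i ∈ s, (1 : ℝ) := by
      simp [mul_comm]
    rw [this]
    have := mul_le_mul_of_nonneg_left hcardtr hlogL
    linarith
  rw [hcard, htr, ← Finset.sum_sub_distrib]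
  simp only [sub_sub_cancel]
  rw [abs_of_nonneg (Finset.sum_nonneg hnn), div_mul_eq_mul_div, le_div_iff₀ hHpos, mul_comm]
  exact hsum

/-- For integers `|a| ≤ a ^ 2`. This trades row sums for diagonal entries of a local matrix, which
`IsLocalFunctional.exists_bound` controls without counting simplices. -/
theorem sum_abs_row_le_sq_diag {n : Type*} [Fintype n] {A : Matrix n n ℤ} (hA : A.IsSymm) (i : n) :
    ∑ j, |A i j| ≤ (A * A) i i := by
  rw [Matrix.mul_apply]
  refine Finset.sum_le_sum fun j _ => ?_
  rw [hA.apply i j]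
  rcases eq_or_ne (A i j) 0 with h | h
  · simp [h]
  · rw [← abs_mul_abs_self]
    exact le_mul_of_one_le_left (abs_nonneg _) (Int.one_le_abs h)

/-! ### Local matrices and local functions of vertices -/

section Locality

/-- An embedding of the vertex sets which identifies a complex with a full subcomplex. -/
def IsFullEmbedding {V' V : Type u} (K' : AbstractSimplicialComplex V')
    (K : AbstractSimplicialComplex V) (ι : V' ↪ V) : Prop :=
  ∀ s : Finset V', s.map ι ∈ K.faces ↔ s ∈ K'.faces

theorem IsFullEmbedding.spans_iff {V' V : Type u} {K' : AbstractSimplicialComplex V'}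
    {K : AbstractSimplicialComplex V} {ι : V' ↪ V} (h : IsFullEmbedding K' K ι) {p : ℕ}
    (a : Fin (p + 1) → V') : Spans K (ι ∘ a) ↔ Spans K' a := by
  classical
  unfold Spans
  rw [← h]
  have : Finset.univ.image (ι ∘ a) = (Finset.univ.image a).map ι := by
    ext
    simp
  convert Iff.rfl
  rw [← Finset.coe_inj] at this ⊢
  simp only [Finset.coe_image, Finset.coe_map] at this ⊢
  exact this.symm

theorem Spans.edist_le {V : Type u} {K : AbstractSimplicialComplex V} {p : ℕ}
    {a : Fin (p + 1) → V} (h : Spans K a) (i j : Fin (p + 1)) :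
    (skeleton K).edist (a i) (a j) ≤ 1 := by
  classical
  by_cases hij : a i = a j
  · simp [hij]
  · refine le_of_eq (SimpleGraph.edist_eq_one_iff_adj.2 ⟨hij, ?_⟩)
    refine (K.isRelLowerSet_faces h).2 ?_ (by simp)
    intro x hx
    simp only [Finset.mem_insert, Finset.mem_singleton] at hx
    rcases hx with rfl | rfl <;> simp

theorem Spans.of_forall_exists {V : Type u} {K : AbstractSimplicialComplex V} {p q : ℕ}
    {b : Fin (p + 1) → V} {a : Fin (q + 1) → V} (hb : Spans K b) (h : ∀ j, ∃ i, a j = b i) :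
    Spans K a := by
  classical
  refine (K.isRelLowerSet_faces hb).2 ?_ (by simp)
  intro v hv
  obtain ⟨j, -, rfl⟩ := Finset.mem_image.1 hv
  obtain ⟨i, hi⟩ := h j
  simp [hi]

/-- An assignment of a matrix with entries indexed by tuples of vertices to each complex. -/
abbrev KernelFamily (R : Type) (m n : ℕ) : Type (u + 1) :=
  ∀ (V : Type u) [Fintype V], AbstractSimplicialComplex V → Matrix (Fin m → V) (Fin n → V) R

/-- The entries of the matrix between far tuples vanish, and the entries in the row of `x` are
determined by the `r`-neighbourhoods of the vertices of `x`. -/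
structure IsLocalKernel {R : Type} [Zero R] {m n : ℕ} (r : ℕ)
    (M : KernelFamily.{u} R m n) : Prop where
  apply_comp : ∀ {V' V : Type u} [Fintype V'] [Fintype V] {K' : AbstractSimplicialComplex V'}
    {K : AbstractSimplicialComplex V} {ι : V' ↪ V}, IsFullEmbedding K' K ι →
    ∀ x y, (∀ i, ballVertices K r (ι (x i)) ⊆ Set.range ι) →
      M V K (ι ∘ x) (ι ∘ y) = M V' K' x y
  edist_le : ∀ {V : Type u} [Fintype V] {K : AbstractSimplicialComplex V} {x y},
    M V K x y ≠ 0 → ∀ j, ∃ i, (skeleton K).edist (x i) (y j) ≤ r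

theorem ballVertices_mono {V : Type u} (K : AbstractSimplicialComplex V) {r s : ℕ} (h : r ≤ s)
    (x : V) : ballVertices K r x ⊆ ballVertices K s x :=
  fun _ hy => le_trans (b := (r : ℕ∞)) hy (by exact_mod_cast h)

theorem ballVertices_subset_of_edist_le {V : Type u} {K : AbstractSimplicialComplex V} {r s : ℕ}
    {x y : V} (h : (skeleton K).edist x y ≤ r) :
    ballVertices K s y ⊆ ballVertices K (r + s) x := by
  intro z hz
  refine SimpleGraph.edist_triangle.trans ((add_le_add h hz).trans ?_)
  simp

variable {R : Type} {m n l r s : ℕ}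

theorem IsLocalKernel.mono [Zero R] {M : KernelFamily.{u} R m n} (h : IsLocalKernel r M)
    (hrs : r ≤ s) : IsLocalKernel s M where
  apply_comp hι x y hx := h.apply_comp hι x y fun i => (ballVertices_mono _ hrs _).trans (hx i)
  edist_le hxy j := (h.edist_le hxy j).imp fun _ hi => hi.trans (by exact_mod_cast hrs)

/-- An intermediate tuple contributes only if its vertices are within `r` of those of `x`. It then
lies in the image of `ι`, and so do the `s`-balls around its vertices. -/
theorem IsLocalKernel.mul [NonUnitalNonAssocSemiring R] {M : KernelFamily.{u} R m n}
    {M' : KernelFamily.{u} R n l} (h : IsLocalKernel r M) (h' : IsLocalKernel s M') :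
    IsLocalKernel (r + s) (fun V _ K => M V K * M' V K) where
  apply_comp {V' V _ _ K' K ι} hι x y hx := by
    have hx' : ∀ i, ballVertices K r (ι (x i)) ⊆ Set.range ι :=
      fun i => (ballVertices_mono K (Nat.le_add_right r s) _).trans (hx i)
    rw [Matrix.mul_apply, Matrix.mul_apply]
    symm
    refine Fintype.sum_of_injective (fun c : Fin n → V' => ι ∘ c) ι.injective.comp_left _ _ ?_ ?_
    · intro c hc
      by_cases hM : M V K (ι ∘ x) c = 0
      · rw [hM, zero_mul]
      · refine absurd ?_ hc
        have hmem : ∀ j, ∃ v, ι v = c j := fun j => by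
          obtain ⟨i, hi⟩ := h.edist_le hM j
          exact hx' i hi
        choose g hg using hmem
        exact ⟨g, funext hg⟩
    · intro c
      rw [h.apply_comp hι x c hx']
      by_cases hM : M V' K' x c = 0
      · rw [hM, zero_mul, zero_mul]
      · rw [h'.apply_comp hι c y]
        intro j
        rw [← h.apply_comp hι x c hx'] at hM
        obtain ⟨i, hi⟩ := h.edist_le hM j
        exact (ballVertices_subset_of_edist_le hi).trans (hx i)
  edist_le {V _ K x y} hxy j := by
    rw [Matrix.mul_apply] at hxy
    obtain ⟨c, -, hc⟩ := Finset.exists_ne_zero_of_sum_ne_zero hxy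
    obtain ⟨k, hk⟩ := h'.edist_le (right_ne_zero_of_mul hc) j
    obtain ⟨i, hi⟩ := h.edist_le (left_ne_zero_of_mul hc) k
    refine ⟨i, SimpleGraph.edist_triangle.trans ((add_le_add hi hk).trans ?_)⟩
    simp

theorem IsLocalKernel.sub [AddGroup R] {M M' : KernelFamily.{u} R m n}
    (h : IsLocalKernel r M) (h' : IsLocalKernel r M') :
    IsLocalKernel r (fun V _ K => M V K - M' V K) where
  apply_comp hι x y hx := by
    rw [Matrix.sub_apply, Matrix.sub_apply, h.apply_comp hι x y hx, h'.apply_comp hι x y hx]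
  edist_le {V _ K x y} hxy j := by
    by_cases hM : M V K x y = 0
    · refine h'.edist_le (fun h0 => hxy ?_) j
      rw [Matrix.sub_apply, hM, h0, sub_zero]
    · exact h.edist_le hM j

theorem IsLocalKernel.smul [MulZeroClass R] (c : R) {M : KernelFamily.{u} R m n}
    (h : IsLocalKernel r M) : IsLocalKernel r (fun V _ K => c • M V K) where
  apply_comp hι x y hx := by
    rw [Matrix.smul_apply, Matrix.smul_apply, h.apply_comp hι x y hx]
  edist_le hxy := h.edist_le (right_ne_zero_of_mul hxy)

theorem IsLocalKernel.map {S : Type} [Zero R] [Zero S] {f : R → S} (hf : f 0 = 0)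
    {M : KernelFamily.{u} R m n} (h : IsLocalKernel r M) :
    IsLocalKernel r (fun V _ K => (M V K).map f) where
  apply_comp hι x y hx := by
    rw [Matrix.map_apply, Matrix.map_apply, h.apply_comp hι x y hx]
  edist_le hxy := h.edist_le fun h0 => hxy (by rw [Matrix.map_apply, h0, hf])

open Classical in
theorem isLocalKernel_one [Zero R] [One R] :
    IsLocalKernel.{u} 0 (fun V _ _ => (1 : Matrix (Fin n → V) (Fin n → V) R)) where
  apply_comp {V' V _ _ K' K ι} hι x y hx := by
    rw [Matrix.one_apply, Matrix.one_apply]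
    simp only [ι.injective.comp_left.eq_iff]
  edist_le hxy j := by
    refine ⟨j, ?_⟩
    rw [Matrix.one_apply, ite_ne_right_iff] at hxy
    simp [hxy.1]

open Classical in
theorem IsLocalKernel.pow [Ring R] {M : KernelFamily.{u} R n n} (h : IsLocalKernel r M) (k : ℕ) :
    IsLocalKernel (k * r) (fun V _ K => M V K ^ k) := by
  induction k with
  | zero => simpa using isLocalKernel_one
  | succ k ih => simpa only [pow_succ, add_mul, one_mul] using ih.mul h

/-- The value of `F` at a vertex is determined by the `r`-neighbourhood of the vertex. -/
structure IsLocalFunctional (r : ℕ)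
    (F : ∀ (V : Type u) [Fintype V], AbstractSimplicialComplex V → V → ℚ) : Prop where
  apply_eq : ∀ {V' V : Type u} [Fintype V'] [Fintype V] {K' : AbstractSimplicialComplex V'}
    {K : AbstractSimplicialComplex V} {ι : V' ↪ V}, IsFullEmbedding K' K ι →
    ∀ v, ballVertices K r (ι v) ⊆ Set.range ι → F V K (ι v) = F V' K' v

theorem IsLocalFunctional.mono
    {F : ∀ (V : Type u) [Fintype V], AbstractSimplicialComplex V → V → ℚ}
    (h : IsLocalFunctional r F) (hrs : r ≤ s) : IsLocalFunctional s F :=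
  ⟨fun hι v hv => h.apply_eq hι v ((ballVertices_mono _ hrs _).trans hv)⟩

theorem IsLocalFunctional.sub
    {F G : ∀ (V : Type u) [Fintype V], AbstractSimplicialComplex V → V → ℚ}
    (h : IsLocalFunctional r F) (h' : IsLocalFunctional r G) :
    IsLocalFunctional r (fun V _ K v => F V K v - G V K v) :=
  ⟨fun hι v hv => by simp only [h.apply_eq hι v hv, h'.apply_eq hι v hv]⟩

open Classical in
/-- The contribution to the trace of the simplices which start at the vertex `v`. -/
noncomputable def traceAt (M : KernelFamily.{u} ℚ (n + 1) (n + 1)) (V : Type u) [Fintype V]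
    (K : AbstractSimplicialComplex V) (v : V) : ℚ :=
  ∑ a : Fin (n + 1) → V, if a 0 = v ∧ Spans K a then M V K a a else 0

/-- The vertices of a simplex through `v` are within distance `1` of `v`, which accounts for the
extra `1` in the radius. -/
theorem IsLocalKernel.isLocalFunctional_traceAt {M : KernelFamily.{u} ℚ (n + 1) (n + 1)}
    (h : IsLocalKernel r M) : IsLocalFunctional (1 + r) (traceAt M) := by
  refine ⟨fun {V' V _ _ K' K ι} hι v hv => ?_⟩
  unfold traceAt
  symm
  refine Fintype.sum_of_injective (fun c : Fin (n + 1) → V' => ι ∘ c) ι.injective.comp_left _ _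
    ?_ ?_
  · intro a ha
    rw [if_neg]
    rintro ⟨h0, hs⟩
    refine ha ?_
    have hmem : ∀ j, ∃ w, ι w = a j := fun j => by
      refine hv (ballVertices_mono K (Nat.le_add_right 1 r) _ ?_)
      rw [← h0]
      exact hs.edist_le 0 j
    choose g hg using hmem
    exact ⟨g, funext hg⟩
  · intro a
    by_cases hc : a 0 = v ∧ Spans K' a
    · rw [if_pos hc, if_pos ⟨congrArg ι hc.1, (hι.spans_iff a).2 hc.2⟩]
      refine (h.apply_comp hι a a fun i => ?_).symm
      refine (ballVertices_subset_of_edist_le (r := 1) ?_).trans hv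
      rw [← hc.1]
      exact ((hι.spans_iff a).2 hc.2).edist_le 0 i
    · rw [if_neg hc, if_neg]
      exact fun h' => hc ⟨ι.injective h'.1, (hι.spans_iff a).1 h'.2⟩

theorem sum_traceAt (M : KernelFamily.{u} ℚ (n + 1) (n + 1)) {V : Type u} [Fintype V]
    {K : AbstractSimplicialComplex V} (h : ∀ a, ¬ Spans K a → M V K a a = 0) :
    ∑ v, traceAt M V K v = (M V K).trace := by
  classical
  unfold traceAt
  rw [Finset.sum_comm, Matrix.trace]
  refine Finset.sum_congr rfl fun a _ => ?_
  simp only [ite_and]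
  rw [Finset.sum_ite_eq]
  by_cases ha : Spans K a <;> simp [ha, h]

end Locality

/-! ### Finitely many ball types -/

section Finiteness

theorem ncard_ballVertices_le {V : Type u} [Finite V] {K : AbstractSimplicialComplex V} {d : ℕ}
    (hK : DegreeBounded K d) (x : V) (r : ℕ) : (ballVertices K r x).ncard ≤ (d + 1) ^ r := by
  classical
  cases nonempty_fintype V
  induction r with
  | zero =>
    have : ballVertices K 0 x = {x} := by
      ext y
      change (skeleton K).edist x y ≤ (0 : ℕ) ↔ y = x
      rw [Nat.cast_zero, nonpos_iff_eq_zero, SimpleGraph.edist_eq_zero_iff, eq_comm]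
    rw [this]
    simp
  | succ r ih =>
    have hsub : ballVertices K (r + 1) x ⊆
        ((ballVertices K r x).toFinset.biUnion
          fun z => insert z ((skeleton K).neighborSet z).toFinset : Finset V) := by
      intro y hy
      have hy' : (skeleton K).edist y x ≤ (r + 1 : ℕ) := by
        rw [SimpleGraph.edist_comm]
        exact hy
      obtain ⟨w, hw⟩ := SimpleGraph.exists_walk_of_edist_ne_top
        (ne_top_of_le_ne_top (ENat.natCast_ne_top (r + 1)) hy')
      rw [← hw] at hy'
      have hl : w.length ≤ r + 1 := by exact_mod_cast hy'
      simp only [Finset.coe_biUnion, Set.mem_iUnion, Finset.mem_coe, Set.mem_toFinset,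
        Finset.mem_insert, SimpleGraph.mem_neighborSet, exists_prop]
      cases w with
      | nil => exact ⟨x, root_mem_ballVertices K r x, Or.inl rfl⟩
      | @cons _ z _ hadj w' =>
        refine ⟨z, ?_, Or.inr hadj.symm⟩
        have h1 := SimpleGraph.edist_le w'
        rw [SimpleGraph.edist_comm] at h1
        refine h1.trans ?_
        simp only [SimpleGraph.Walk.length_cons] at hl
        exact_mod_cast Nat.le_of_succ_le_succ hl
    refine (Set.ncard_le_ncard hsub).trans ?_
    rw [Set.ncard_coe_finset]
    refine (Finset.card_biUnion_le_card_mul _ _ (d + 1) fun z _ => ?_).trans ?_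
    · refine (Finset.card_insert_le _ _).trans ?_
      have := hK z
      rw [Set.encard_eq_coe_toFinset_card] at this
      exact Nat.succ_le_succ (by exact_mod_cast this)
    · rw [pow_succ, ← Set.ncard_eq_toFinset_card']
      exact Nat.mul_le_mul_right _ ih

theorem RootedBall.card_le {d r : ℕ} (B : RootedBall.{u} d r) :
    Nat.card B.carrier ≤ (d + 1) ^ r := by
  have := B.finite
  rw [← Set.ncard_univ]
  refine le_trans (le_of_eq ?_) (ncard_ballVertices_le B.degreeBounded B.root r)
  congr 1
  exact (Set.eq_univ_of_forall B.edist_le).symm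

/-- Number the vertices of each ball inside a fixed finite set. The images of the simplices and of
the root determine the class: every singleton is a simplex, so the image of the vertex set can be
read off too. -/
theorem finite_ballType (d r : ℕ) : Finite (BallType.{u} d r) := by
  classical
  have hemb : ∀ B : RootedBall.{u} d r, Nonempty (B.carrier ↪ Fin ((d + 1) ^ r)) := by
    intro B
    have := B.finite
    cases nonempty_fintype B.carrier
    have h := B.card_le
    rw [Nat.card_eq_fintype_card] at h
    exact Function.Embedding.nonempty_of_card_le (by simpa using h)
  have e : ∀ B : RootedBall.{u} d r, B.carrier ↪ Fin ((d + 1) ^ r) := fun B => (hemb B).some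
  let code : BallType.{u} d r → Set (Finset (Fin ((d + 1) ^ r))) × Fin ((d + 1) ^ r) := fun q =>
    ((fun s => s.map (e q.out)) '' q.out.complex.faces, e q.out q.out.root)
  refine Finite.of_injective code fun p q hpq => ?_
  rw [← Quotient.out_eq p, ← Quotient.out_eq q]
  refine Quotient.sound ?_
  obtain ⟨hfaces, hroot⟩ := Prod.ext_iff.1 hpq
  simp only [code] at hfaces hroot
  generalize p.out = A at *
  generalize q.out = B at *
  have hrange : ∀ (A B : RootedBall.{u} d r), (fun s => s.map (e A)) '' A.complex.faces =
      (fun s => s.map (e B)) '' B.complex.faces → ∀ a, ∃ b, e B b = e A a := by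
    intro A B h a
    obtain ⟨s, -, hs⟩ : ({a} : Finset A.carrier).map (e A) ∈
        (fun s => s.map (e B)) '' B.complex.faces := by
      rw [← h]
      exact ⟨_, A.complex.singleton_mem a, rfl⟩
    have : e A a ∈ s.map (e B) := by
      simp only at hs
      rw [hs]
      simp
    obtain ⟨b, -, hb⟩ := Finset.mem_map.1 this
    exact ⟨b, hb⟩
  choose f hf using hrange A B hfaces
  choose g hg using hrange B A hfaces.symm
  let φ : A.carrier ≃ B.carrier :=
    ⟨f, g, fun a => (e A).injective (by rw [hg, hf]), fun b => (e B).injective (by rw [hf, hg])⟩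
  refine ⟨φ, (e B).injective ((hf _).trans hroot), fun s => ?_⟩
  have hs : (s.map φ.toEmbedding).map (e B) = s.map (e A) := by
    rw [Finset.map_map]
    congr 1
    ext a
    exact congrArg Fin.val (hf a)
  constructor
  · intro h
    obtain ⟨t, ht, hts⟩ : s.map (e A) ∈ (fun s => s.map (e A)) '' A.complex.faces := by
      rw [hfaces, ← hs]
      exact ⟨_, h, rfl⟩
    rwa [← Finset.map_injective _ hts]
  · intro h
    obtain ⟨t, ht, hts⟩ : (s.map φ.toEmbedding).map (e B) ∈
        (fun s => s.map (e B)) '' B.complex.faces := by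
      rw [hs, ← hfaces]
      exact ⟨_, h, rfl⟩
    rwa [← Finset.map_injective _ hts]

/-- Locality is applied twice: to an isomorphism of balls, so that the value at the root descends to
classes, and to the inclusion of a ball in `K`. -/
theorem IsLocalFunctional.exists_eq_neighbourhoodType {r : ℕ}
    {F : ∀ (V : Type u) [Fintype V], AbstractSimplicialComplex V → V → ℚ}
    (h : IsLocalFunctional r F) (d : ℕ) : ∃ g : BallType.{u} d r → ℚ,
      ∀ (V : Type u) [Fintype V] (K : AbstractSimplicialComplex V) (hK : DegreeBounded K d) (v : V),
        g (neighbourhoodType K hK r v) = F V K v := by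
  classical
  have fin : ∀ B : RootedBall.{u} d r, Fintype B.carrier := fun B =>
    have := B.finite
    Fintype.ofFinite _
  refine ⟨Quotient.lift (fun B => letI := fin B; F B.carrier B.complex B.root) ?_, ?_⟩
  · rintro A B ⟨e, he, hs⟩
    let := fin A
    let := fin B
    change F A.carrier A.complex A.root = F B.carrier B.complex B.root
    rw [← he]
    exact (h.apply_eq (ι := e.toEmbedding) hs A.root (fun y _ => e.surjective y)).symm
  · intro V _ K hK v
    let := fin (neighbourhood K hK r v)
    change F (neighbourhood K hK r v).carrier (neighbourhood K hK r v).complex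
      (neighbourhood K hK r v).root = _
    refine (h.apply_eq (V := V) (K := K) (V' := (neighbourhood K hK r v).carrier)
      (ι := Function.Embedding.subtype (· ∈ ballVertices K r v)) (fun s => Iff.rfl)
      (neighbourhood K hK r v).root ?_).symm
    intro y hy
    exact ⟨⟨y, hy⟩, rfl⟩

theorem IsLocalFunctional.exists_bound {r : ℕ}
    {F : ∀ (V : Type u) [Fintype V], AbstractSimplicialComplex V → V → ℚ}
    (h : IsLocalFunctional r F) (d : ℕ) : ∃ M : ℕ, 1 ≤ M ∧
      ∀ (V : Type u) [Fintype V] (K : AbstractSimplicialComplex V), DegreeBounded K d → ∀ v,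
        |F V K v| ≤ M := by
  obtain ⟨g, hg⟩ := h.exists_eq_neighbourhoodType d
  have := finite_ballType.{u} d r
  obtain ⟨M, hM⟩ := (Set.finite_range fun b => |g b|).bddAbove
  refine ⟨⌈M⌉₊ + 1, by simp, fun V _ K hK v => ?_⟩
  rw [← hg V K hK v]
  refine (hM ⟨_, rfl⟩).trans ((Nat.le_ceil M).trans ?_)
  simp

end Finiteness

/-! ### Second moments and the sampling tester -/

section Sampling

/-- Variance of a sum of independent centred variables: splitting off one sample, the cross term
vanishes because `∑ v, h v = 0`. -/
theorem sum_sq_sum_le {V : Type u} [Fintype V] (h : V → ℝ) {M : ℝ}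
    (h0 : ∑ v, h v = 0) (hM : ∀ v, h v ^ 2 ≤ M) (C : ℕ) :
    ∑ x : Fin C → V, (∑ i, h (x i)) ^ 2 ≤ C * (Fintype.card V : ℝ) ^ C * M := by
  classical
  induction C with
  | zero => simp
  | succ C ih =>
    rw [← (Fin.consEquiv fun _ : Fin (C + 1) => V).sum_comp, Fintype.sum_prod_type]
    simp only [Fin.consEquiv_apply, Fin.sum_univ_succ, Fin.cons_zero, Fin.cons_succ, add_sq,
      Finset.sum_add_distrib, Finset.sum_const, Finset.card_univ, Fintype.card_pi_const,
      nsmul_eq_mul, ← Finset.mul_sum, ← Finset.sum_mul]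
    rw [h0]
    have h1 : ∑ v, h v ^ 2 ≤ Fintype.card V * M := by
      simpa using Finset.sum_le_sum fun v (_ : v ∈ Finset.univ) => hM v
    have h2 := mul_le_mul_of_nonneg_left h1 (by positivity : 0 ≤ (Fintype.card V : ℝ) ^ C)
    have h3 := mul_le_mul_of_nonneg_left ih (by positivity : 0 ≤ (Fintype.card V : ℝ))
    push_cast
    rw [pow_succ]
    linarith

/-- Chebyshev's inequality. -/
theorem uniformProb_lt_abs_sum_le {V : Type u} [Fintype V] [Nonempty V] (h : V → ℝ) {M δ : ℝ}
    (h0 : ∑ v, h v = 0) (hM : ∀ v, h v ^ 2 ≤ M) (hδ : 0 < δ) {C : ℕ} (hC : 0 < C) :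
    uniformProb {x : Fin C → V | C * δ < |∑ i, h (x i)|} ≤ M / (C * δ ^ 2) := by
  classical
  have hC' : (0 : ℝ) < C := by exact_mod_cast hC
  have hn : (0 : ℝ) < (Fintype.card V : ℝ) ^ C := by
    have : 0 < Fintype.card V := Fintype.card_pos
    positivity
  unfold uniformProb
  rw [Nat.card_eq_fintype_card, Fintype.card_pi_const]
  push_cast
  rw [div_le_div_iff₀ hn (by positivity), Set.ncard_eq_toFinset_card']
  have h1 : ((Set.toFinset {x : Fin C → V | C * δ < |∑ i, h (x i)|}).card : ℝ) * (C * δ) ^ 2 ≤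
      ∑ x : Fin C → V, (∑ i, h (x i)) ^ 2 := by
    rw [← nsmul_eq_mul, ← Finset.sum_const]
    refine (Finset.sum_le_sum fun x hx => ?_).trans
      (Finset.sum_le_univ_sum_of_nonneg fun x => sq_nonneg _)
    rw [Set.mem_toFinset] at hx
    rw [← sq_abs (∑ i, h (x i))]
    exact pow_le_pow_left₀ (by positivity) (le_of_lt hx) 2
  have h2 := h1.trans (sum_sq_sum_le h h0 hM C)
  have h3 : (C : ℝ) * (((Set.toFinset {x : Fin C → V | C * δ < |∑ i, h (x i)|}).card : ℝ) *
      (C * δ ^ 2)) ≤ C * (M * (Fintype.card V : ℝ) ^ C) := by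
    linarith
  exact le_of_mul_le_mul_left h3 hC'

/-- Up to an arbitrarily small multiple of the number of vertices, `β` is the sum over the vertices
of a function determined by neighbourhoods of bounded radius. -/
def LocallyApproximable (d : ℕ) (β : ∀ V : Type u, AbstractSimplicialComplex V → ℝ) : Prop :=
  ∀ ε : ℝ, 0 < ε → ∃ (r : ℕ) (F : ∀ (V : Type u) [Fintype V], AbstractSimplicialComplex V → V → ℚ),
    IsLocalFunctional r F ∧
    ∀ (V : Type u) [Fintype V] (K : AbstractSimplicialComplex V), DegreeBounded K d →
      |β V K - ((∑ v, F V K v : ℚ) : ℝ)| ≤ ε * Fintype.card V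

theorem LocallyApproximable.sub {d : ℕ} {β γ : ∀ V : Type u, AbstractSimplicialComplex V → ℝ}
    (hβ : LocallyApproximable d β) (hγ : LocallyApproximable d γ) :
    LocallyApproximable d (fun V K => β V K - γ V K) := by
  intro ε hε
  obtain ⟨r, F, hF, hF'⟩ := hβ (ε / 2) (by positivity)
  obtain ⟨s, G, hG, hG'⟩ := hγ (ε / 2) (by positivity)
  refine ⟨max r s, _, (hF.mono (le_max_left r s)).sub (hG.mono (le_max_right r s)),
    fun V _ K hK => ?_⟩
  have h1 := abs_le.1 (hF' V K hK)
  have h2 := abs_le.1 (hG' V K hK)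
  rw [Finset.sum_sub_distrib, abs_le]
  push_cast at *
  constructor <;> linarith [h1.1, h1.2, h2.1, h2.2]

/-- The tester averages the local function over the samples. Half of `ε` pays for the local
approximation, half for the sampling error. Every large `C` works, which later allows one `C` for
several `p`. -/
theorem LocallyApproximable.exists_tester {d : ℕ}
    {β : ∀ V : Type u, AbstractSimplicialComplex V → ℝ} (hβ : LocallyApproximable d β) {ε : ℝ}
    (hε : 0 < ε) : ∃ C₀ : ℕ, ∀ C, C₀ ≤ C → ∃ tester : (Fin C → BallType.{u} d C) → ℚ,
      ∀ (V : Type u) [Finite V] [Nonempty V] (K : AbstractSimplicialComplex V)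
        (hK : DegreeBounded K d),
        uniformProb {x : Fin C → V |
          ε < |(Nat.card V : ℝ) * (tester fun i => neighbourhoodType K hK C (x i) : ℚ)
                - β V K| / (Nat.card V : ℝ)} < ε := by
  obtain ⟨r, F, hF, hF'⟩ := hβ (ε / 2) (by positivity)
  obtain ⟨M, hM1, hM⟩ := hF.exists_bound d
  -- The centred function is at most `2 * M` in absolute value, so Chebyshev with deviation `ε / 2`
  -- gives probability below `ε` from this size on.
  obtain ⟨C₁, hC₁⟩ := exists_nat_gt ((2 * (M : ℝ)) ^ 2 / (ε / 2) ^ 2 / ε)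
  refine ⟨max r (C₁ + 1), fun C hC => ?_⟩
  have hCr : r ≤ C := (le_max_left _ _).trans hC
  have hCC₁ : C₁ + 1 ≤ C := (le_max_right _ _).trans hC
  have hCpos : 0 < C := by omega
  have hC' : (0 : ℝ) < C := by exact_mod_cast hCpos
  obtain ⟨g, hg⟩ := (hF.mono hCr).exists_eq_neighbourhoodType d
  refine ⟨fun b => (∑ i, g (b i)) / C, fun V _ _ K hK => ?_⟩
  cases nonempty_fintype V
  rw [Nat.card_eq_fintype_card]
  simp only [hg V K hK]
  have hn : (0 : ℝ) < Fintype.card V := by exact_mod_cast Fintype.card_pos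
  set μ : ℝ := (∑ v, (F V K v : ℝ)) / Fintype.card V with hμ
  have hμM : |μ| ≤ M := by
    rw [hμ, abs_div, abs_of_pos hn, div_le_iff₀ hn]
    refine (Finset.abs_sum_le_sum_abs _ _).trans ?_
    refine (Finset.sum_le_sum fun v _ => (?_ : |(F V K v : ℝ)| ≤ M)).trans ?_
    · exact_mod_cast hM V K hK v
    · simp [mul_comm]
  have h0 : ∑ v, ((F V K v : ℝ) - μ) = 0 := by
    rw [Finset.sum_sub_distrib, hμ]
    simp only [Finset.sum_const, Finset.card_univ, nsmul_eq_mul]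
    field_simp
    ring
  have hM2 : ∀ v, ((F V K v : ℝ) - μ) ^ 2 ≤ (2 * (M : ℝ)) ^ 2 := by
    intro v
    rw [sq_le_sq, abs_of_nonneg (by positivity : (0 : ℝ) ≤ 2 * M)]
    have : |(F V K v : ℝ)| ≤ M := by exact_mod_cast hM V K hK v
    refine (abs_sub _ _).trans ?_
    linarith
  have hprob := uniformProb_lt_abs_sum_le _ h0 hM2 (half_pos hε) hCpos
  have hlt : (2 * (M : ℝ)) ^ 2 / (C * (ε / 2) ^ 2) < ε := by
    rw [mul_comm (C : ℝ), ← div_div, div_lt_iff₀ hC']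
    rw [div_lt_iff₀ hε] at hC₁
    refine hC₁.trans ?_
    rw [mul_comm ε]
    refine mul_lt_mul_of_pos_right ?_ hε
    exact_mod_cast hCC₁
  refine lt_of_le_of_lt (le_trans ?_ hprob) hlt
  unfold uniformProb
  refine div_le_div_of_nonneg_right ?_ (by positivity)
  refine Nat.cast_le.2 (Set.ncard_le_ncard ?_)
  intro x hx
  simp only [Set.mem_ofPred_eq] at hx ⊢
  rw [lt_div_iff₀ hn] at hx
  have happ := hF' V K hK
  push_cast at hx happ
  have hμ' : ∑ v, (F V K v : ℝ) = Fintype.card V * μ := by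
    rw [hμ]
    field_simp
  rw [hμ'] at happ
  have hsum : ∑ i, ((F V K (x i) : ℝ) - μ) = C * ((∑ i, (F V K (x i) : ℝ)) / C - μ) := by
    rw [Finset.sum_sub_distrib]
    simp only [Finset.sum_const, Finset.card_univ, nsmul_eq_mul, Fintype.card_fin]
    field_simp
  rw [hsum, abs_mul, abs_of_pos hC']
  refine mul_lt_mul_of_pos_left ?_ hC'
  generalize (∑ i, (F V K (x i) : ℝ)) / C = T at *
  have h1 : |(Fintype.card V : ℝ) * T - β V K| ≤
      Fintype.card V * |T - μ| + |β V K - Fintype.card V * μ| := by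
    rw [← abs_of_pos hn, ← abs_mul, abs_of_pos hn, abs_sub_comm (β V K)]
    refine le_trans (le_of_eq ?_) (abs_add_le _ _)
    congr 1
    ring
  have h2 : ε / 2 * Fintype.card V < |T - μ| * Fintype.card V := by linarith
  exact lt_of_mul_lt_mul_right h2 hn.le

end Sampling

/-! ### Local approximation of ranks -/

section RankApproximation

open Matrix

/-- This polynomial in `A` has no constant term, so zero rows stay zero. Hence its trace sees only
tuples that span simplices. -/
theorem one_sub_one_sub_smul_pow_apply_eq_zero {n : Type*} [Fintype n] [DecidableEq n]
    {A : Matrix n n ℚ} {i : n} (h : ∀ j, A i j = 0) (c : ℚ) (k : ℕ) (j : n) :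
    (1 - (1 - c • A) ^ k) i j = 0 := by
  have hrow : ((1 - c • A) ^ k) i j = (1 : Matrix n n ℚ) i j := by
    induction k with
    | zero => simp
    | succ k ih =>
      rw [pow_succ', sub_mul, one_mul, Matrix.sub_apply, ih, smul_mul_assoc, Matrix.smul_apply, mul_apply]
      simp [h]
  rw [Matrix.sub_apply, hrow, sub_self]

theorem ratCast_trace_one_sub_pow {n : Type*} [Fintype n] [DecidableEq n] (A : Matrix n n ℤ)
    (L k : ℕ) :
    (((1 - (1 - (L : ℚ)⁻¹ • A.map (Int.cast : ℤ → ℚ)) ^ k).trace : ℚ) : ℝ) =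
      (1 - (1 - (L : ℝ)⁻¹ • A.map (Int.cast : ℤ → ℝ)) ^ k).trace := by
  have h := AddMonoidHom.map_trace (Rat.castHom ℝ) (1 - (1 - (L : ℚ)⁻¹ • A.map (Int.cast : ℤ → ℚ)) ^ k)
  refine h.trans (congrArg trace ?_)
  change (Rat.castHom ℝ).mapMatrix _ = _
  rw [map_sub, map_pow, map_sub, map_one]
  congr 3
  ext i j
  simp

theorem exists_log_div_sum_mul_le (L : ℕ) {ε : ℝ} (hε : 0 < ε) : ∃ k : ℕ, 0 < k ∧
    Real.log L / (∑ j ∈ Finset.range k, 1 / ((j : ℝ) + 1)) * L ≤ ε := by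
  have h := Real.tendsto_sum_range_one_div_nat_succ_atTop
  have h1 := (Filter.Tendsto.const_div_atTop h (Real.log L)).mul_const (L : ℝ)
  rw [zero_mul] at h1
  obtain ⟨k, hk, hk'⟩ := ((h1.eventually_le_const hε).and (Filter.eventually_gt_atTop 0)).exists
  exact ⟨k, hk', hk⟩

theorem LocallyApproximable.of_eq_rank {d m n : ℕ}
    {β : ∀ V : Type u, AbstractSimplicialComplex V → ℝ} (N : KernelFamily.{u} ℤ (m + 1) (n + 1))
    (hcomp : ∀ {V' V : Type u} [Fintype V'] [Fintype V] {K' : AbstractSimplicialComplex V'}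
      {K : AbstractSimplicialComplex V} {ι : V' ↪ V}, IsFullEmbedding K' K ι →
      ∀ b a, N V K (ι ∘ b) (ι ∘ a) = N V' K' b a)
    (hsupp : ∀ {V : Type u} [Fintype V] {K : AbstractSimplicialComplex V} {b a},
      N V K b a ≠ 0 → Spans K b ∧ ∀ j, ∃ i, a j = b i)
    (hβ : ∀ (V : Type u) [Fintype V] (K : AbstractSimplicialComplex V),
      β V K = ((N V K).map (Int.cast : ℤ → ℝ)).rank) : LocallyApproximable d β := by
  classical
  intro ε hε
  have hN : IsLocalKernel 0 N :=
    ⟨fun hι x y _ => hcomp hι x y, fun h j => ((hsupp h).2 j).imp fun i hi => by simp [hi]⟩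
  -- The vertices of the row index now lie in the simplex spanned by the column index, hence the
  -- radius `1`.
  have hNt : IsLocalKernel 1 (fun V _ K => (N V K)ᵀ) := by
    refine ⟨fun hι x y _ => hcomp hι y x, fun {V _ K x y} h j => ⟨0, ?_⟩⟩
    obtain ⟨i, hi⟩ := (hsupp h).2 0
    rw [hi]
    exact (hsupp h).1.edist_le i j
  set A : KernelFamily.{u} ℤ (n + 1) (n + 1) := fun V _ K => (N V K)ᵀ * N V K with hA
  have hAloc : IsLocalKernel (1 + 0) A := hNt.mul hN
  have hAsymm : ∀ (V : Type u) [Fintype V] (K : AbstractSimplicialComplex V), (A V K).IsSymm :=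
    fun V _ K => by simp [hA, Matrix.IsSymm, transpose_mul]
  have hAsupp : ∀ {V : Type u} [Fintype V] {K : AbstractSimplicialComplex V} {a},
      ¬ Spans K a → ∀ c, A V K a c = 0 := by
    intro V _ K a ha c
    by_contra h
    obtain ⟨b, -, hb⟩ := Finset.exists_ne_zero_of_sum_ne_zero h
    obtain ⟨hs, hr⟩ := hsupp (left_ne_zero_of_mul hb)
    exact ha (hs.of_forall_exists hr)
  set S : KernelFamily.{u} ℚ (n + 1) (n + 1) :=
    fun V _ K => (A V K * A V K).map (Int.cast : ℤ → ℚ) with hS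
  have hSloc := IsLocalKernel.map (f := (Int.cast : ℤ → ℚ)) Int.cast_zero (hAloc.mul hAloc)
  -- This one bound on the local traces of `A ^ 2` controls both the row sums of `A` and, summed
  -- over the vertices, the trace of `A`.
  obtain ⟨L, hL1, hL⟩ := hSloc.isLocalFunctional_traceAt.exists_bound d
  obtain ⟨k, hk, hkε⟩ := exists_log_div_sum_mul_le L hε
  have hQloc := isLocalKernel_one.{u} (n := n + 1) (R := ℚ) |>.mono (Nat.zero_le (k * (1 + 0)))
    |>.sub (((isLocalKernel_one.mono (Nat.zero_le (1 + 0))).sub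
      ((IsLocalKernel.map (f := (Int.cast : ℤ → ℚ)) Int.cast_zero hAloc).smul (L : ℚ)⁻¹)).pow k)
  refine ⟨_, _, hQloc.isLocalFunctional_traceAt, fun V _ K hK => ?_⟩
  have hSsupp : ∀ a, ¬ Spans K a → S V K a a = 0 := by
    intro a ha
    simp [hS, mul_apply, hAsupp ha]
  have hSnn : ∀ a, 0 ≤ S V K a a := by
    intro a
    have : 0 ≤ (A V K * A V K) a a :=
      (Finset.sum_nonneg fun _ _ => abs_nonneg _).trans (sum_abs_row_le_sq_diag (hAsymm V K) a)
    simpa only [hS, map_apply] using Int.cast_nonneg this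
  have hSL : ∀ a, S V K a a ≤ L := by
    intro a
    by_cases ha : Spans K a
    · refine le_trans ?_ ((le_abs_self _).trans (hL V K hK (a 0)))
      unfold traceAt
      refine le_trans (le_of_eq ?_) (Finset.single_le_sum (f := fun c : Fin (n + 1) → V =>
        if c 0 = a 0 ∧ Spans K c then S V K c c else 0) (fun c _ => ?_) (Finset.mem_univ a))
      · simp [ha]
      · split_ifs
        exacts [hSnn c, le_rfl]
    · rw [hSsupp a ha]
      positivity
  have hrow : ∀ a, ((∑ c, |A V K a c| : ℤ) : ℝ) ≤ L := by
    intro a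
    have h1 := sum_abs_row_le_sq_diag (hAsymm V K) a
    have h2 := hSL a
    simp only [hS, map_apply] at h2
    have h3 : (A V K * A V K) a a ≤ L := by exact_mod_cast h2
    exact_mod_cast h1.trans h3
  have htr : (((A V K).trace : ℤ) : ℝ) ≤ L * Fintype.card V := by
    have h1 : (((A V K).trace : ℤ) : ℚ) ≤ (S V K).trace := by
      rw [trace, trace, Int.cast_sum]
      refine Finset.sum_le_sum fun a _ => ?_
      simp only [hS, diag_apply, map_apply]
      refine Int.cast_le.2 (le_trans ?_ (sum_abs_row_le_sq_diag (hAsymm V K) a))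
      exact (le_abs_self _).trans
        (Finset.single_le_sum (f := fun c => |A V K a c|) (fun _ _ => abs_nonneg _)
          (Finset.mem_univ a))
    have h2 : (S V K).trace ≤ L * Fintype.card V := by
      rw [← sum_traceAt S hSsupp]
      refine (Finset.sum_le_sum fun v _ => (le_abs_self _).trans (hL V K hK v)).trans ?_
      simp [mul_comm]
    exact_mod_cast h1.trans h2
  rw [sum_traceAt _ fun a ha => ?_, hβ, ratCast_trace_one_sub_pow]
  · refine (abs_rank_sub_trace_le (N V K) (by exact_mod_cast hL1) hrow hk).trans ?_
    have hlog : 0 ≤ Real.log L / (∑ j ∈ Finset.range k, 1 / ((j : ℝ) + 1)) :=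
      div_nonneg (Real.log_natCast_nonneg L) (Finset.sum_nonneg fun _ _ => by positivity)
    refine (mul_le_mul_of_nonneg_left htr hlog).trans ?_
    rw [← mul_assoc]
    exact mul_le_mul_of_nonneg_right hkε (by positivity)
  · exact one_sub_one_sub_smul_pow_apply_eq_zero (fun j => by simp [hAsupp ha]) _ _ _

end RankApproximation

/-! ### Cochains and coboundaries as ranges of integer matrices -/

section CochainMatrices

open Matrix

theorem Spans.comp_perm_iff {V : Type u} {K : AbstractSimplicialComplex V} {p : ℕ}
    {a : Fin (p + 1) → V} (σ : Equiv.Perm (Fin (p + 1))) : Spans K (a ∘ σ) ↔ Spans K a :=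
  ⟨fun h => h.of_forall_exists fun j => ⟨σ⁻¹ j, by simp⟩,
    fun h => h.of_forall_exists fun j => ⟨σ j, rfl⟩⟩

open Classical in
/-- The matrix of the unnormalized alternation on the functions of `p + 1` vertices, followed by the
restriction to the simplices. -/
noncomputable def alternation (p : ℕ) : KernelFamily.{u} ℤ (p + 1) (p + 1) := fun _ _ K b a =>
  if Spans K b then
    ∑ σ : Equiv.Perm (Fin (p + 1)), if b ∘ σ = a then (Equiv.Perm.sign σ : ℤ) else 0
  else 0

open Classical in
/-- The matrix of the coboundary of the unnormalized alternation. -/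
noncomputable def alternatingCoboundary (p : ℕ) : KernelFamily.{u} ℤ (p + 2) (p + 1) :=
  fun _ _ K b a =>
    if Spans K b then ∑ i : Fin (p + 2), (-1) ^ (i : ℕ) *
      ∑ σ : Equiv.Perm (Fin (p + 1)),
        if (b ∘ i.succAbove) ∘ σ = a then (Equiv.Perm.sign σ : ℤ) else 0
    else 0

theorem alternation_comp {p : ℕ} {V' V : Type u} [Fintype V'] [Fintype V]
    {K' : AbstractSimplicialComplex V'} {K : AbstractSimplicialComplex V} {ι : V' ↪ V}
    (hι : IsFullEmbedding K' K ι) (b a) :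
    alternation p V K (ι ∘ b) (ι ∘ a) = alternation p V' K' b a := by
  classical
  unfold alternation
  refine if_congr (hι.spans_iff b) (Finset.sum_congr rfl fun σ _ => ?_) rfl
  exact if_congr (ι.injective.comp_left.eq_iff (a := b ∘ σ)) rfl rfl

theorem alternatingCoboundary_comp {p : ℕ} {V' V : Type u} [Fintype V'] [Fintype V]
    {K' : AbstractSimplicialComplex V'} {K : AbstractSimplicialComplex V} {ι : V' ↪ V}
    (hι : IsFullEmbedding K' K ι) (b a) :
    alternatingCoboundary p V K (ι ∘ b) (ι ∘ a) = alternatingCoboundary p V' K' b a := by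
  classical
  unfold alternatingCoboundary
  refine if_congr (hι.spans_iff b) (Finset.sum_congr rfl fun i _ => ?_) rfl
  refine congrArg _ (Finset.sum_congr rfl fun σ _ => ?_)
  exact if_congr (ι.injective.comp_left.eq_iff (a := (b ∘ i.succAbove) ∘ σ)) rfl rfl

theorem alternation_support {p : ℕ} {V : Type u} [Fintype V] {K : AbstractSimplicialComplex V}
    {b a} (h : alternation p V K b a ≠ 0) : Spans K b ∧ ∀ j, ∃ i, a j = b i := by
  classical
  unfold alternation at h
  rw [ite_ne_right_iff] at h
  obtain ⟨σ, -, hσ⟩ := Finset.exists_ne_zero_of_sum_ne_zero h.2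
  rw [ite_ne_right_iff] at hσ
  exact ⟨h.1, fun j => ⟨σ j, congrFun hσ.1.symm j⟩⟩

theorem alternatingCoboundary_support {p : ℕ} {V : Type u} [Fintype V]
    {K : AbstractSimplicialComplex V} {b a} (h : alternatingCoboundary p V K b a ≠ 0) :
    Spans K b ∧ ∀ j, ∃ i, a j = b i := by
  classical
  unfold alternatingCoboundary at h
  rw [ite_ne_right_iff] at h
  obtain ⟨i, -, hi⟩ := Finset.exists_ne_zero_of_sum_ne_zero h.2
  obtain ⟨σ, -, hσ⟩ := Finset.exists_ne_zero_of_sum_ne_zero (right_ne_zero_of_mul hi)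
  rw [ite_ne_right_iff] at hσ
  exact ⟨h.1, fun j => ⟨_, congrFun hσ.1.symm j⟩⟩

open Classical in
theorem alternation_mulVec {p : ℕ} {V : Type u} [Fintype V] (K : AbstractSimplicialComplex V)
    (f : (Fin (p + 1) → V) → ℝ) (b : Fin (p + 1) → V) :
    ((alternation p V K).map (Int.cast : ℤ → ℝ) *ᵥ f) b =
      if Spans K b then ∑ σ : Equiv.Perm (Fin (p + 1)), ((Equiv.Perm.sign σ : ℤ) : ℝ) * f (b ∘ σ)
      else 0 := by
  simp only [mulVec, dotProduct, map_apply, alternation]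
  split_ifs with h
  · simp only [Int.cast_sum, Finset.sum_mul]
    rw [Finset.sum_comm]
    refine Finset.sum_congr rfl fun σ _ => ?_
    simp [Int.cast_ite, ite_mul]
  · simp

/-- Faces of a simplex are simplices, so the restriction built into the alternation loses nothing
here. -/
theorem alternatingCoboundary_mulVec {p : ℕ} {V : Type u} [Fintype V]
    (K : AbstractSimplicialComplex V) (f : (Fin (p + 1) → V) → ℝ) :
    (alternatingCoboundary p V K).map (Int.cast : ℤ → ℝ) *ᵥ f =
      coboundary K p ((alternation p V K).map (Int.cast : ℤ → ℝ) *ᵥ f) := by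
  classical
  ext b
  change _ = if Spans K b then ∑ i : Fin (p + 2), (-1 : ℝ) ^ (i : ℕ) *
    ((alternation p V K).map (Int.cast : ℤ → ℝ) *ᵥ f) (b ∘ i.succAbove) else 0
  simp only [alternation_mulVec]
  simp only [mulVec, dotProduct, map_apply, alternatingCoboundary]
  split_ifs with h
  · have hface : ∀ i : Fin (p + 2), Spans K (b ∘ i.succAbove) :=
      fun i => h.of_forall_exists fun j => ⟨_, rfl⟩
    simp only [if_pos (hface _), Int.cast_sum, Finset.sum_mul]
    rw [Finset.sum_comm]
    refine Finset.sum_congr rfl fun i _ => ?_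
    simp only [Int.cast_mul, Int.cast_sum, Finset.mul_sum, Finset.sum_mul]
    rw [Finset.sum_comm]
    refine Finset.sum_congr rfl fun σ _ => ?_
    simp [Int.cast_ite, ite_mul, mul_assoc]
  · simp

theorem range_alternation {p : ℕ} {V : Type u} [Fintype V] (K : AbstractSimplicialComplex V) :
    LinearMap.range ((alternation p V K).map (Int.cast : ℤ → ℝ)).mulVecLin = cochains K p := by
  classical
  apply le_antisymm
  · rintro _ ⟨f, rfl⟩
    refine ⟨fun a ha => ?_, fun a τ => ?_⟩
    · rw [mulVecLin_apply, alternation_mulVec, if_neg ha]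
    · rw [mulVecLin_apply, alternation_mulVec, alternation_mulVec]
      simp only [Spans.comp_perm_iff]
      split_ifs
      · rw [← Equiv.sum_comp (Equiv.mulLeft τ) fun σ => ((Equiv.Perm.sign σ : ℤ) : ℝ) * f (a ∘ σ),
          Finset.mul_sum]
        refine Finset.sum_congr rfl fun σ _ => ?_
        simp only [Equiv.coe_mulLeft, Equiv.Perm.sign_mul, Units.val_mul, Int.cast_mul,
          Equiv.Perm.coe_mul, Function.comp_assoc]
        rw [← mul_assoc, ← mul_assoc, ← Int.cast_mul, ← Units.val_mul, Int.units_mul_self]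
        simp
      · simp
  · rintro f ⟨hf, hf'⟩
    -- On alternating functions the unnormalized alternation is multiplication by `(p + 1)!`.
    refine ⟨((Fintype.card (Equiv.Perm (Fin (p + 1))) : ℝ))⁻¹ • f, ?_⟩
    rw [map_smul, mulVecLin_apply]
    ext b
    rw [Pi.smul_apply, alternation_mulVec]
    split_ifs with h
    · simp only [hf', ← mul_assoc, ← Int.cast_mul, ← Units.val_mul, Int.units_mul_self]
      have : (Fintype.card (Equiv.Perm (Fin (p + 1))) : ℝ) ≠ 0 := by
        exact_mod_cast Fintype.card_ne_zero
      simp only [Units.val_one, Int.cast_one, one_mul, Finset.sum_const, Finset.card_univ,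
        nsmul_eq_mul, smul_eq_mul]
      field_simp
    · rw [hf b h, smul_zero]

theorem range_alternatingCoboundary {p : ℕ} {V : Type u} [Fintype V]
    (K : AbstractSimplicialComplex V) :
    LinearMap.range ((alternatingCoboundary p V K).map (Int.cast : ℤ → ℝ)).mulVecLin =
      (cochains K p).map (coboundary K p) := by
  rw [← range_alternation, ← LinearMap.range_comp]
  congr 1
  exact LinearMap.ext (alternatingCoboundary_mulVec K)

theorem locallyApproximable_finrank_cochains (d p : ℕ) :
    LocallyApproximable.{u} d (fun _ K => Module.finrank ℝ (cochains K p)) :=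
  .of_eq_rank (alternation p) alternation_comp alternation_support fun V _ K => by
    rw [← range_alternation]
    rfl

theorem locallyApproximable_finrank_map_coboundary (d p : ℕ) :
    LocallyApproximable.{u} d
      (fun _ K => Module.finrank ℝ ((cochains K p).map (coboundary K p))) :=
  .of_eq_rank (alternatingCoboundary p) alternatingCoboundary_comp alternatingCoboundary_support
    fun V _ K => by
      rw [← range_alternatingCoboundary]
      rfl

end CochainMatrices

/-! ### Betti numbers -/

section Betti

theorem finrank_map_add_finrank_inf_ker {E F : Type*} [AddCommGroup E] [Module ℝ E]
    [AddCommGroup F] [Module ℝ F] [FiniteDimensional ℝ E] (S : Submodule ℝ E) (f : E →ₗ[ℝ] F) :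
    Module.finrank ℝ (S.map f) + Module.finrank ℝ (S ⊓ LinearMap.ker f : Submodule ℝ E) =
      Module.finrank ℝ S := by
  rw [← (f.domRestrict S).finrank_range_add_finrank_ker, LinearMap.range_domRestrict,
    LinearMap.ker_domRestrict, ← Submodule.map_comap_subtype, Submodule.finrank_map_subtype_eq]

theorem finrank_cocycles {V : Type u} [Finite V] (K : AbstractSimplicialComplex V) (p : ℕ) :
    (Module.finrank ℝ (cocycles K p) : ℝ) = Module.finrank ℝ (cochains K p) -
      Module.finrank ℝ ((cochains K p).map (coboundary K p)) := by
  cases nonempty_fintype V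
  rw [← finrank_map_add_finrank_inf_ker (cochains K p) (coboundary K p)]
  push_cast
  rw [add_sub_cancel_left]
  rfl

theorem LocallyApproximable.congr {d : ℕ} {β γ : ∀ V : Type u, AbstractSimplicialComplex V → ℝ}
    (h : LocallyApproximable d β)
    (hβγ : ∀ (V : Type u) [Finite V] (K : AbstractSimplicialComplex V), γ V K = β V K) :
    LocallyApproximable d γ := by
  intro ε hε
  obtain ⟨r, F, hF, hF'⟩ := h ε hε
  refine ⟨r, F, hF, fun V _ K hK => ?_⟩
  rw [hβγ]
  exact hF' V K hK

theorem locallyApproximable_betti (d p : ℕ) :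
    LocallyApproximable.{u} d (fun _ K => (betti K p : ℝ)) := by
  have h := (locallyApproximable_finrank_cochains.{u} d p).sub
    (locallyApproximable_finrank_map_coboundary d p)
  cases p with
  | zero =>
    refine h.congr fun V _ K => ?_
    have h0 : Module.finrank ℝ (coboundaries K 0) = 0 := finrank_bot _ _
    rw [← finrank_cocycles, betti, h0]
    simp
  | succ p =>
    refine (h.sub (locallyApproximable_finrank_map_coboundary d p)).congr fun V _ K => ?_
    rw [← finrank_cocycles, betti]
    push_cast
    rfl

/-- A `p`-simplex gives each of its vertices `p` neighbours. On a tuple with a repetition, the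
transposition of two equal entries forces the value `0`. -/
theorem cochains_eq_bot {V : Type u} {K : AbstractSimplicialComplex V} {d p : ℕ}
    (hK : DegreeBounded K d) (hp : d < p) : cochains K p = ⊥ := by
  classical
  rw [eq_bot_iff]
  rintro f ⟨hf, hf'⟩
  rw [Submodule.mem_bot]
  ext a
  by_cases ha : Spans K a
  · by_cases hinj : Function.Injective a
    · exfalso
      have h1 : Set.range (fun i : Fin p => a i.succ) ⊆ (skeleton K).neighborSet (a 0) := by
        rintro _ ⟨i, rfl⟩
        refine ⟨fun h => Fin.succ_ne_zero i (hinj h).symm,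
          (K.isRelLowerSet_faces ha).2 ?_ (by simp)⟩
        intro x hx
        simp only [Finset.mem_insert, Finset.mem_singleton] at hx
        rcases hx with rfl | rfl <;> simp
      have h2 := (Set.encard_le_encard h1).trans (hK (a 0))
      have h3 : Function.Injective fun i : Fin p => a i.succ := hinj.comp (Fin.succ_injective p)
      rw [← Set.image_univ, h3.encard_image,
        Set.encard_univ, ENat.card_eq_coe_fintype_card, Fintype.card_fin] at h2
      exact absurd (by exact_mod_cast h2) (not_le.2 hp)
    · obtain ⟨i, j, hij, hne⟩ := Function.not_injective_iff.1 hinj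
      have h1 := hf' a (Equiv.swap i j)
      have h2 : a ∘ Equiv.swap i j = a := by
        ext k
        rcases eq_or_ne k i with rfl | hki
        · simp [hij]
        · rcases eq_or_ne k j with rfl | hkj
          · simp [hij]
          · simp [Equiv.swap_apply_of_ne_of_ne hki hkj]
      rw [h2, Equiv.Perm.sign_swap hne] at h1
      simp only [Units.val_neg, Units.val_one, Int.cast_neg, Int.cast_one, neg_mul, one_mul] at h1
      change f a = 0
      linarith
  · exact hf a ha

/-- With `p > d + 1` the cochains in degree `p - 1` vanish as well, so the coboundaries are zero
without comparing them with cocycles. -/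
theorem betti_eq_zero {V : Type u} {K : AbstractSimplicialComplex V} {d p : ℕ}
    (hK : DegreeBounded K d) (hp : d + 1 < p) : betti K p = 0 := by
  obtain ⟨q, rfl⟩ : ∃ q, p = q + 1 := ⟨p - 1, by omega⟩
  change (Module.finrank ℝ (cochains K (q + 1) ⊓ LinearMap.ker (coboundary K (q + 1)) :
    Submodule ℝ _) : ℤ) - (Module.finrank ℝ ((cochains K q).map (coboundary K q)) : ℤ) = 0
  rw [cochains_eq_bot hK (by omega), cochains_eq_bot hK (by omega : d < q), bot_inf_eq,
    Submodule.map_bot, finrank_bot, sub_self]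

end Betti

end BettiTesting

open BettiTesting in
theorem theorem1 (d : ℕ) (ε : ℝ) (hε : 0 < ε) :
    ∃ C : ℕ,
      Finite (BallType.{u} d C) ∧
      ∀ p : ℕ, ∃ tester : (Fin C → BallType.{u} d C) → ℚ,
        ∀ (V : Type u) [Finite V] [Nonempty V] (K : AbstractSimplicialComplex V)
          (hK : DegreeBounded K d),
          uniformProb {x : Fin C → V |
            ε < |(Nat.card V : ℝ) * (tester fun i => neighbourhoodType K hK C (x i) : ℚ)
                  - (betti K p : ℝ)| / (Nat.card V : ℝ)} < ε := by
  choose C hC using fun p => (locallyApproximable_betti.{u} d p).exists_tester hε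
  -- One `C` must serve all `p`. Only `p ≤ d + 1` impose a condition; beyond that the Betti number
  -- is `0` and the zero tester is exact.
  refine ⟨(Finset.range (d + 2)).sup C, finite_ballType _ _, fun p => ?_⟩
  by_cases hp : p < d + 2
  · exact hC p _ (Finset.le_sup (Finset.mem_range.2 hp))
  · refine ⟨fun _ => 0, fun V _ _ K hK => ?_⟩
    rw [betti_eq_zero hK (by omega)]
    simpa [uniformProb, not_lt.2 hε.le] using hε
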